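/- **Model.** Let $S$ be a compact metrizable space, $A$ a Borel subset of a Polish space, and $\mathcal Z$ a standard Borel space; let $N\ge 1$ and $\beta\in(0,1)$. For each $x\in S$ let $D(x)\subset A$, and let $D=\{(x,a)\in S\times A: a\in D(x)\}$ contain the graph of a measurable map $S\to A$. Let $\mathbb P(S)$ be the space of probability measures on $S$ with the weak topology, $T:S\times A\times\mathbb P(S)\times\mathcal Z^2\to S$ measurable, and $r:S\times A\times \mathbb P(S)\to\mathbb R$ bounded. Let $Z^1_n,\dots,Z^N_n,Z^0_n$ $(n\ge 1)$ be independent $\mathcal Z$-valued random variables, where all $Z^i_n$, $1\le i\le N$, have the same law and all $Z^0_n$ have the same law; write $\mathbf Z_n=(Z_n^1,\dots,Z_n^N)$, and let $(\mathbf Z,Z^0)$ be distributed as $(\mathbf Z_n,Z^0_n)$. For $\mathbf x\in S^N$, $\mathbf a\in A^N$ put $$\mu[\mathbf x]=\frac1N\sum_{i=1}^N\delta_{x_i},\quad \mathbf D(\mathbf x)=D(x_1)\times\dots\times D(x_N),\quad \mathbf r(\mathbf x,\mathbf a)=\frac1N\sum_{i=1}^N r(x_i,a_i,\mu[\mathbf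 x]),$$ $$\mathbf T(\mathbf x,\mathbf a,\mu[\mathbf x],\mathbf z,z^0)=\big(T(x_i,a_i,\mu[\mathbf x],z^i,z^0)\big)_{i=1,\dots,N}.$$ Let $F$ be the set of measurable $f:S^N\to A^N$ with $f(\mathbf x)\in\mathbf D(\mathbf x)$ for all $\mathbf x$. A policy is a sequence $\pi=(f_0,f_1,\dots)$ in $F$. Let $\mathbb P^\pi_{\mathbf x}$ be the law on $(S^N)^{\mathbb N_0}$ of the process $\mathbf X_0=\mathbf x$, $\mathbf X_{n+1}=\mathbf T(\mathbf X_n,\mathbf A_n,\mu[\mathbf X_n],\mathbf Z_{n+1},Z^0_{n+1})$, with $\mathbf A_n=f_n(\mathbf X_n)$. Define $$V^N_\pi(\mathbf x)=\frac1N\sum_{i=1}^N\sum_{k=0}^\infty\beta^k\,\mathbb E^\pi_{\mathbf x}\big[r(X^i_k,A^i_k,\mu[\mathbf X_k])\big],\qquad V^N(\mathbf x)=\sup_\pi V^N_\pi(\mathbf x).$$ A policy $\pi$ is optimal if $V^N_\pi(\mathbf x)=V^N(\mathbf x)$ for all $\mathbf x\in S^N$. Let $\mathbb M$ be the set of bounded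 upper semicontinuous functions $v:S^N\to\mathbb R$, and let $$Uv(\mathbf x)=\sup_{\mathbf a\in\mathbf D(\mathbf x)}\Big\{\mathbf r(\mathbf x,\mathbf a)+\beta\,\mathbb E\big[v(\mathbf T(\mathbf x,\mathbf a,\mu[\mathbf x],\mathbf Z,Z^0))\big]\Big\}.$$ A rule $f\in F$ is a maximizer of $v\in\mathbb M$ if for every $\mathbf x\in S^N$ the supremum defining $Uv(\mathbf x)$ is attained at $\mathbf a=f(\mathbf x)$. **Theorem.** Assume: - (A0) $D$ is compact. - (A1) For all $x\in S$: if $x_n\to x$ and $a_n\in D(x_n)$, then $(a_n)$ has an accumulation point in $D(x)$. - (A2) $(x,a,\mu)\mapsto r(x,a,\mu)$ is upper semicontinuous. - (A3) $(x,a,\mu)\mapsto T(x,a,\mu,z,z_0)$ is continuous for all $z,z_0\in\mathcal Z$. Then: a) $U$ maps $\mathbb M$ into $\mathbb M$, and $V^N$ is the unique fixed point of $U$ in $\mathbb M$. b) $V^N=\lim_{n\to\infty}U^n0$, uniformly on $S^N$. c) There exists a maximizer $f^*\in F$ of $V^N$, and for every maximizer $f^*\in F$ of $V^N$ the stationary deterministic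 policy $(f^*,f^*,\dots)$ is optimal. -/

import Mathlib

open MeasureTheory Filter
open scoped Topology ENNReal

noncomputable section

/-- The data of the mean-field model for statistically equal individuals with state space `S`,
action space `A` and disturbance space `Z`, together with its standing conventions.
`lawZ` is the common law of the idiosyncratic disturbances `Z_n^i`, `lawZ0` the law of the common
disturbances `Z_n^0`; all disturbances are independent. -/
structure MeanFieldModel (S A Z : Type*) [MeasurableSpace S] [MeasurableSpace A]
    [MeasurableSpace Z] where
  /-- actions available to an individual in state `x` -/
  D : S → Set A
  /-- transition function of an individual -/
  T : S → A → ProbabilityMeasure S → Z → Z → S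
  /-- one-stage reward of an individual -/
  r : S → A → ProbabilityMeasure S → ℝ
  /-- law of the idiosyncratic noise -/
  lawZ : ProbabilityMeasure Z
  /-- law of the common noise -/
  lawZ0 : ProbabilityMeasure Z
  /-- discount factor -/
  β : ℝ
  /-- the graph of `D` contains the graph of a measurable mapping -/
  exists_selector : ∃ f : S → A, Measurable f ∧ ∀ x, f x ∈ D x
  measurable_T : Measurable fun p : S × A × ProbabilityMeasure S × Z × Z =>
    T p.1 p.2.1 p.2.2.1 p.2.2.2.1 p.2.2.2.2
  bounded_r : ∃ C : ℝ, ∀ x a μ, |r x a μ| ≤ C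
  β_pos : 0 < β
  β_lt_one : β < 1

/-- The empirical measure `μ[x] = (1/N) ∑ i, δ_{x i}`. -/
def empiricalMeasure {S : Type*} [MeasurableSpace S] {N : ℕ} [NeZero N] (x : Fin N → S) :
    ProbabilityMeasure S :=
  ⟨(N : ℝ≥0∞)⁻¹ • ∑ i, Measure.dirac (x i), ⟨by
    simp only [Measure.smul_apply, Measure.finsetSum_apply, measure_univ, Finset.sum_const,
      Finset.card_univ, Fintype.card_fin, smul_eq_mul, nsmul_eq_mul, mul_one]
    exact ENNReal.inv_mul_cancel (by exact_mod_cast NeZero.ne N) (ENNReal.natCast_ne_top N)⟩⟩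

namespace MeanFieldModel

variable {S A Z : Type*} [MeasurableSpace S] [MeasurableSpace A] [MeasurableSpace Z]

/-- The set `D = {(x, a) | a ∈ D(x)}`. -/
def graph (M : MeanFieldModel S A Z) : Set (S × A) := {p | p.2 ∈ M.D p.1}

/-- The set `𝐃(𝐱) = D(x_1) × … × D(x_N)` of admissible joint actions. -/
def jointD (M : MeanFieldModel S A Z) {N : ℕ} (x : Fin N → S) : Set (Fin N → A) :=
  {a | ∀ i, a i ∈ M.D (x i)}

/-- The joint one-stage reward `𝐫(𝐱, 𝐚)`. -/
def jointReward (M : MeanFieldModel S A Z) {N : ℕ} [NeZero N] (x : Fin N → S) (a : Fin N → A) : ℝ :=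
  (1 / (N : ℝ)) * ∑ i, M.r (x i) (a i) (empiricalMeasure x)

/-- The joint transition function `𝐓(𝐱, 𝐚, μ, 𝐳, z⁰)`; the noise is `w = (𝐳, z⁰)`. -/
def jointT (M : MeanFieldModel S A Z) {N : ℕ} (x : Fin N → S) (a : Fin N → A)
    (μ : ProbabilityMeasure S) (w : (Fin N → Z) × Z) : Fin N → S :=
  fun i => M.T (x i) (a i) μ (w.1 i) w.2

/-- The law of the disturbances `((Z^1, …, Z^N), Z^0)` of one period. -/
def noiseLaw (M : MeanFieldModel S A Z) (N : ℕ) : Measure ((Fin N → Z) × Z) :=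
  (Measure.pi fun _ : Fin N => (M.lawZ : Measure Z)).prod (M.lawZ0 : Measure Z)

/-- The set `F` of decision rules. -/
def DecisionRule (M : MeanFieldModel S A Z) (N : ℕ) : Type _ :=
  {f : (Fin N → S) → (Fin N → A) // Measurable f ∧ ∀ x, f x ∈ M.jointD x}

/-- Policies `π = (f_0, f_1, …)`. -/
abbrev Policy (M : MeanFieldModel S A Z) (N : ℕ) : Type _ := ℕ → M.DecisionRule N

/-- The states `𝐱_0 = 𝐱`, `𝐱_{n+1} = 𝐓(𝐱_n, f_n(𝐱_n), μ[𝐱_n], 𝐙_{n+1}, Z^0_{n+1})` along a noise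
sequence `w`, where `w n = (𝐙_{n+1}, Z^0_{n+1})`. -/
def trajectory (M : MeanFieldModel S A Z) {N : ℕ} [NeZero N] (π : M.Policy N) (x : Fin N → S)
    (w : ℕ → (Fin N → Z) × Z) : ℕ → (Fin N → S)
  | 0 => x
  | n + 1 =>
    M.jointT (M.trajectory π x w n) ((π n).1 (M.trajectory π x w n))
      (empiricalMeasure (M.trajectory π x w n)) (w n)

/-- The probability measure `ℙ_𝐱^π` on `S^N × S^N × …`: the law of the state sequence that is
driven by an i.i.d. sequence of disturbances. -/
def pathLaw (M : MeanFieldModel S A Z) {N : ℕ} [NeZero N] (π : M.Policy N) (x : Fin N → S) :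
    Measure (ℕ → (Fin N → S)) :=
  (Measure.infinitePi fun _ : ℕ => M.noiseLaw N).map (M.trajectory π x)

/-- The expected discounted reward `V_π^N(𝐱)` of a policy; the states are `𝐗_k(ω) = ω k` and
the actions are `𝐀_k(ω) = f_k(ω k)`. -/
def policyValue (M : MeanFieldModel S A Z) {N : ℕ} [NeZero N] (π : M.Policy N)
    (x : Fin N → S) : ℝ :=
  (1 / (N : ℝ)) * ∑ i : Fin N, ∑' k : ℕ, M.β ^ k *
    ∫ ω, M.r (ω k i) ((π k).1 (ω k) i) (empiricalMeasure (ω k)) ∂(M.pathLaw π x)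

/-- The value function `V^N(𝐱) = sup_π V_π^N(𝐱)`. -/
def value (M : MeanFieldModel S A Z) {N : ℕ} [NeZero N] (x : Fin N → S) : ℝ :=
  ⨆ π : M.Policy N, M.policyValue π x

/-- A policy is optimal if it attains the value function at every initial state. -/
def IsOptimal (M : MeanFieldModel S A Z) {N : ℕ} [NeZero N] (π : M.Policy N) : Prop :=
  ∀ x, M.policyValue π x = M.value x

/-- The expression `𝐫(𝐱, 𝐚) + β 𝔼[v(𝐓(𝐱, 𝐚, μ[𝐱], 𝐙, Z^0))]`. -/
def oneStep (M : MeanFieldModel S A Z) {N : ℕ} [NeZero N] (v : (Fin N → S) → ℝ)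
    (x : Fin N → S) (a : Fin N → A) : ℝ :=
  M.jointReward x a + M.β * ∫ w, v (M.jointT x a (empiricalMeasure x) w) ∂(M.noiseLaw N)

/-- The Bellman operator `U`. -/
def bellman (M : MeanFieldModel S A Z) {N : ℕ} [NeZero N] (v : (Fin N → S) → ℝ) :
    (Fin N → S) → ℝ :=
  fun x => ⨆ a : M.jointD x, M.oneStep v x a

/-- `f` is a maximizer of `v`. -/
def IsMaximizer (M : MeanFieldModel S A Z) {N : ℕ} [NeZero N] (f : M.DecisionRule N)
    (v : (Fin N → S) → ℝ) : Prop :=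
  ∀ x, M.bellman v x = M.oneStep v x (f.1 x)

end MeanFieldModel

/-- The set `𝕄` of bounded upper semicontinuous functions `S^N → ℝ`. -/
def boundedUSC (S : Type*) [TopologicalSpace S] (N : ℕ) : Set ((Fin N → S) → ℝ) :=
  {v | (∃ C : ℝ, ∀ x, |v x| ≤ C) ∧ UpperSemicontinuous v}

end

/-! The proof rests on upper semicontinuity, compactness and a verification argument. For `v` in 𝕄,
Fatou's lemma makes the one-step return jointly upper semicontinuous in state and action
(`upperSemicontinuous_oneStep`). The joint action graph is compact, so the supremum in `U` is
attained, the superlevel sets of `Uv` are projections of compact sets, and the maximizing action can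
be chosen measurably (`exists_measurable_isMaxOn`). Hence `U` preserves 𝕄 and maximizers exist.

Since `U` contracts uniform distances by the factor `β`, its iterates from 0 converge uniformly to a
fixed point in 𝕄 (`exists_tendstoUniformly_iterate_bellman`).

A fixed point `v` in 𝕄 is then compared with policies. The next noise is independent of the current
state, so the mean one-step return at time `k` is the mean reward plus `β` times the mean of `v` at
time `k + 1`. Discounting and telescoping give value at most `v` for every policy
(`policyValue_le`), with equality for the stationary policy of a maximizer (`policyValue_eq`). Thus
every such fixed point is the value function, which yields uniqueness and optimality together. -/

/-! ### Semicontinuity of integrals depending on a parameter. -/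

/-- Fatou's lemma as lower semicontinuity of an integral depending on a parameter. -/
theorem lowerSemicontinuous_lintegral {P Ω : Type*} [TopologicalSpace P] [SequentialSpace P]
    [MeasurableSpace Ω] {μ : Measure Ω} {F : P → Ω → ℝ≥0∞} (hm : ∀ p, Measurable (F p))
    (hF : ∀ w, LowerSemicontinuous fun p => F p w) :
    LowerSemicontinuous fun p => ∫⁻ w, F p w ∂μ := by
  rw [lowerSemicontinuous_iff_isClosed_preimage]
  intro y
  -- Fatou's lemma controls sequences only; in a sequential space these suffice to test closedness.
  apply IsSeqClosed.isClosed
  intro ps p hps hp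
  simp only [Set.mem_preimage, Set.mem_Iic] at hps ⊢
  calc ∫⁻ w, F p w ∂μ ≤ ∫⁻ w, liminf (fun n => F (ps n) w) atTop ∂μ := by
        refine lintegral_mono fun w => ?_
        refine ((hF w).le_liminf p).trans ?_
        exact liminf_le_liminf_of_le hp
    _ ≤ liminf (fun n => ∫⁻ w, F (ps n) w ∂μ) atTop := lintegral_liminf_le fun n => hm (ps n)
    _ ≤ liminf (fun _ : ℕ => y) atTop := liminf_le_liminf (Eventually.of_forall hps)
    _ = y := by simp

theorem upperSemicontinuous_integral {P Ω : Type*} [TopologicalSpace P] [SequentialSpace P]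
    [MeasurableSpace Ω] {μ : Measure Ω} [IsProbabilityMeasure μ] {G : P → Ω → ℝ} {C : ℝ}
    (hm : ∀ p, Measurable (G p)) (hb : ∀ p w, |G p w| ≤ C)
    (hG : ∀ w, UpperSemicontinuous fun p => G p w) :
    UpperSemicontinuous fun p => ∫ w, G p w ∂μ := by
  rw [upperSemicontinuous_iff_isClosed_preimage]
  intro y
  -- In `max C y`, the bound `C` makes the integrand nonnegative, and `y` keeps the level `max C y -
  -- y` nonnegative, so that `ENNReal.ofReal` loses nothing in the comparison.
  have hlsc : LowerSemicontinuous fun p => ∫⁻ w, ENNReal.ofReal (max C y - G p w) ∂μ := by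
    refine lowerSemicontinuous_lintegral (fun p => ?_) fun w => ?_
    · have := hm p
      fun_prop
    · exact (ENNReal.continuous_ofReal.comp (continuous_sub_left (max C y))).comp_upperSemicontinuous_antitone (hG w) fun s t h =>
          ENNReal.ofReal_le_ofReal (by linarith)
  convert (lowerSemicontinuous_iff_isClosed_preimage.1 hlsc) (ENNReal.ofReal (max C y - y)) using 1
  ext p
  have hint : Integrable (G p) μ :=
    Integrable.of_bound (hm p).aestronglyMeasurable C (Eventually.of_forall fun w => hb p w)
  have heq : ∫⁻ w, ENNReal.ofReal (max C y - G p w) ∂μ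
      = ENNReal.ofReal (max C y - ∫ w, G p w ∂μ) := by
    have hi : Integrable (fun w => max C y - G p w) μ := (integrable_const _).sub hint
    rw [← ofReal_integral_eq_lintegral_ofReal hi
      (Eventually.of_forall fun w => sub_nonneg.2
        (((le_abs_self _).trans (hb p w)).trans (le_max_left _ _))),
      integral_sub (integrable_const _) hint]
    simp
  simp only [Set.mem_preimage, Set.mem_Ici, Set.mem_Iic, heq]
  rw [ENNReal.ofReal_le_ofReal_iff (sub_nonneg.2 (le_max_right _ _)), sub_le_sub_iff_left]

/-! ### Maximization over compact sections and measurable selection. -/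

/-- The set is the projection of a compact set. Taking `L` to be everything handles the maximum
itself; smaller `L` locate the maximizer. -/
theorem isClosed_setOf_exists_le {X Y : Type*} [TopologicalSpace X] [T2Space X]
    [TopologicalSpace Y] [T2Space Y] {K : Set (X × Y)} (hK : IsCompact K) {L : Set Y}
    (hL : IsClosed L) {u : X × Y → ℝ} (hu : UpperSemicontinuous u) (c : ℝ) :
    IsClosed {x | ∃ y ∈ L, (x, y) ∈ K ∧ c ≤ u (x, y)} := by
  have h : IsCompact (K ∩ (u ⁻¹' Set.Ici c ∩ Prod.snd ⁻¹' L)) :=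
    hK.inter_right ((hu.isClosed_preimage c).inter (hL.preimage continuous_snd))
  convert (h.image continuous_fst).isClosed using 1
  ext x
  constructor
  · rintro ⟨y, hy, hxy, hc⟩
    exact ⟨(x, y), ⟨hxy, hc, hy⟩, rfl⟩
  · rintro ⟨⟨x', y⟩, ⟨hxy, hc, hy⟩, rfl⟩
    exact ⟨y, hy, hxy, hc⟩

theorem isCompact_section {X Y : Type*} [TopologicalSpace X] [T2Space X]
    [TopologicalSpace Y] [T2Space Y] {K : Set (X × Y)} (hK : IsCompact K) (x : X) :
    IsCompact {y | (x, y) ∈ K} := by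
  refine (hK.image continuous_snd).of_isClosed_subset
    (hK.isClosed.preimage (by fun_prop : Continuous fun y : Y => (x, y))) ?_
  intro y hy
  exact ⟨(x, y), hy, rfl⟩

theorem upperSemicontinuous_section {X Y : Type*} [TopologicalSpace X]
    [TopologicalSpace Y] {u : X × Y → ℝ} (hu : UpperSemicontinuous u) (x : X) :
    UpperSemicontinuous fun y => u (x, y) :=
  hu.comp (g := fun y => (x, y)) (by fun_prop)

/-- The set of points at which a constrained maximum reaches a measurable level is measurable. -/
theorem measurableSet_exists_le {X Y : Type*} [TopologicalSpace X] [T2Space X]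
    [MeasurableSpace X] [OpensMeasurableSpace X]
    [TopologicalSpace Y] [T2Space Y] {K : Set (X × Y)} (hK : IsCompact K) {L : Set Y}
    (hL : IsClosed L) {u : X × Y → ℝ} (hu : UpperSemicontinuous u) {m : X → ℝ}
    (hm : Measurable m) :
    MeasurableSet {x | ∃ y ∈ L, (x, y) ∈ K ∧ m x ≤ u (x, y)} := by
  have heq : {x | ∃ y ∈ L, (x, y) ∈ K ∧ m x ≤ u (x, y)}
      -- As `m` is only measurable, its level is approached by rationals from below. The maximum
      -- over a compact section is attained, so exceeding every rational below `m x` means reaching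
      -- `m x`.
      = ⋂ q : ℚ, {x | m x ≤ q} ∪ {x | ∃ y ∈ L, (x, y) ∈ K ∧ (q : ℝ) ≤ u (x, y)} := by
    ext x
    simp only [Set.mem_iInter, Set.mem_union, Set.mem_ofPred_eq]
    constructor
    · rintro ⟨y, hy, hxy, hle⟩ q
      rcases le_or_gt (m x) q with h | h
      · exact Or.inl h
      · exact Or.inr ⟨y, hy, hxy, h.le.trans hle⟩
    · intro h
      have hc : IsCompact ({y | (x, y) ∈ K} ∩ L) := (isCompact_section hK x).inter_right hL
      have hne : ({y | (x, y) ∈ K} ∩ L).Nonempty := by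
        obtain ⟨q, hq⟩ := exists_rat_lt (m x)
        rcases h q with h' | ⟨y, hy, hxy, -⟩
        · exact absurd hq h'.not_gt
        · exact ⟨y, hxy, hy⟩
      obtain ⟨y, ⟨hxy, hy⟩, hmax⟩ :=
        ((upperSemicontinuous_section hu x).upperSemicontinuousOn _).exists_isMaxOn hne hc
      refine ⟨y, hy, hxy, ?_⟩
      by_contra! hlt
      obtain ⟨q, hq1, hq2⟩ := exists_rat_btwn hlt
      rcases h q with h' | ⟨z, hz, hxz, hle⟩
      · exact absurd hq2 h'.not_gt
      · exact absurd (hle.trans (hmax ⟨hxz, hz⟩)) hq1.not_ge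
  rw [heq]
  exact MeasurableSet.iInter fun q => (measurableSet_le hm measurable_const).union
    (isClosed_setOf_exists_le hK hL hu _).measurableSet

/-- A nonempty compact metrizable set is covered by a continuous image of the Cantor set. -/
theorem exists_continuous_cantorSet_image {Y : Type*} [TopologicalSpace Y]
    [TopologicalSpace.MetrizableSpace Y] {L : Set Y} (hL : IsCompact L) (hne : L.Nonempty) :
    ∃ ψ : cantorSet → Y, Continuous ψ ∧ Set.range ψ = L := by
  let _ : MetricSpace L := TopologicalSpace.metrizableSpaceMetric L
  have : CompactSpace L := isCompact_iff_compactSpace.1 hL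
  have : Nonempty L := hne.to_subtype
  obtain ⟨φ, hφ, hs⟩ := exists_nat_bool_continuous_surjective_of_compact L
  refine ⟨fun c => (φ (cantorSetHomeomorphNatToBool c) : Y), by fun_prop, ?_⟩
  ext y
  constructor
  · rintro ⟨c, rfl⟩
    exact Subtype.mem _
  · intro hy
    obtain ⟨b, hb⟩ := hs ⟨y, hy⟩
    exact ⟨cantorSetHomeomorphNatToBool.symm b, by simp [hb]⟩

/-- A measurable selection theorem: an upper semicontinuous function on a compact set with nonempty
sections attains its maxima over the sections along a measurable map. -/
theorem exists_measurable_isMaxOn {X Y : Type*} [TopologicalSpace X] [T2Space X]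
    [MeasurableSpace X] [OpensMeasurableSpace X] [TopologicalSpace Y]
    [TopologicalSpace.MetrizableSpace Y] [MeasurableSpace Y] [BorelSpace Y]
    {K : Set (X × Y)} (hK : IsCompact K) (hne : ∀ x, ∃ y, (x, y) ∈ K) {u : X × Y → ℝ}
    (hu : UpperSemicontinuous u) :
    ∃ f : X → Y, Measurable f ∧ ∀ x, (x, f x) ∈ K ∧ ∀ y, (x, y) ∈ K → u (x, y) ≤ u (x, f x) := by
  have hmax : ∀ x, ∃ y, (x, y) ∈ K ∧ ∀ z, (x, z) ∈ K → u (x, z) ≤ u (x, y) := fun x =>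
    ((upperSemicontinuous_section hu x).upperSemicontinuousOn _).exists_isMaxOn
      (hne x) (isCompact_section hK x)
  choose g hgK hg using hmax
  have hm : Measurable fun x => u (x, g x) := by
    refine measurable_of_Ici fun c => ?_
    convert (isClosed_setOf_exists_le hK isClosed_univ hu c).measurableSet using 1
    ext x
    exact ⟨fun h => ⟨g x, trivial, hgK x, h⟩, fun ⟨y, _, hy, h⟩ => h.trans (hg x y hy)⟩
  rcases isEmpty_or_nonempty X with hX | ⟨⟨x₀⟩⟩
  · exact ⟨g, measurable_of_empty g, fun x => ⟨hgK x, hg x⟩⟩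
  -- Coding actions by points of the Cantor set borrows the order of the reals, which singles out
  -- one maximizer: the one with the least code.
  obtain ⟨ψ, hψ, hr⟩ := exists_continuous_cantorSet_image (hK.image continuous_snd)
    ⟨g x₀, (x₀, g x₀), hgK x₀, rfl⟩
  have : CompactSpace cantorSet := isCompact_iff_compactSpace.1 isCompact_cantorSet
  let C : X → Set cantorSet := fun x => {c | (x, ψ c) ∈ K ∧ u (x, g x) ≤ u (x, ψ c)}
  have hC : ∀ x, ∃ c ∈ C x, ∀ d ∈ C x, (c : ℝ) ≤ d := by
    intro x
    have hcl : IsClosed (C x) :=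
      (hK.isClosed.preimage (by fun_prop : Continuous fun c => (x, ψ c))).inter
        ((hu.isClosed_preimage (u (x, g x))).preimage
          (by fun_prop : Continuous fun c => (x, ψ c)))
    have hn : (C x).Nonempty := by
      obtain ⟨c, hc⟩ : g x ∈ Set.range ψ := hr ▸ ⟨(x, g x), hgK x, rfl⟩
      exact ⟨c, by simp only [C, Set.mem_ofPred_eq, hc, hgK x, le_refl, and_self]⟩
    exact hcl.isCompact.exists_isMinOn hn continuous_subtype_val.continuousOn
  choose s hsC hs using hC
  refine ⟨fun x => ψ (s x), hψ.measurable.comp ?_, fun x =>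
    ⟨(hsC x).1, fun y hy => (hg x y hy).trans (hsC x).2⟩⟩
  refine Measurable.subtype_mk (f := fun x => (s x : ℝ)) (measurable_of_Iic fun t => ?_)
  have hLt : IsCompact (ψ '' {c | (c : ℝ) ≤ t}) :=
    (isClosed_le continuous_subtype_val continuous_const).isCompact.image hψ
  -- The least code is at most `t` exactly when some maximizer lies in the compact image of the
  -- codes up to `t`.
  convert measurableSet_exists_le hK hLt.isClosed hu hm using 1
  ext x
  constructor
  · exact fun h => ⟨ψ (s x), ⟨s x, h, rfl⟩, hsC x⟩
  · rintro ⟨_, ⟨c, hc, rfl⟩, h⟩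
    exact (hs x c h).trans hc

/-! ### Empirical measures. -/

section EmpiricalMeasure

variable {S : Type*} [MeasurableSpace S] {N : ℕ} [NeZero N]

theorem integral_empiricalMeasure (x : Fin N → S) {g : S → ℝ} (hg : StronglyMeasurable g) :
    ∫ s, g s ∂(empiricalMeasure x : Measure S) = (N : ℝ)⁻¹ * ∑ i, g (x i) := by
  change ∫ s, g s ∂((N : ℝ≥0∞)⁻¹ • ∑ i, Measure.dirac (x i)) = _
  rw [integral_smul_measure, integral_finsetSum_measure]
  · simp [integral_dirac' g _ hg]
  · intro i _
    exact integrable_dirac' hg (by simp)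

theorem continuous_empiricalMeasure [TopologicalSpace S] [OpensMeasurableSpace S]
    [SecondCountableTopology S] :
    Continuous (empiricalMeasure : (Fin N → S) → ProbabilityMeasure S) := by
  rw [ProbabilityMeasure.continuous_iff_forall_continuous_integral]
  intro g
  simp_rw [integral_empiricalMeasure _ g.continuous.stronglyMeasurable]
  fun_prop

/-- The σ-algebra on `ProbabilityMeasure S` is generated by evaluation on measurable sets, so this
is checked set by set rather than deduced from weak continuity. -/
theorem measurable_empiricalMeasure :
    Measurable (empiricalMeasure : (Fin N → S) → ProbabilityMeasure S) := by
  refine Measurable.subtype_mk (Measure.measurable_of_measurable_coe _ fun s hs => ?_)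
  simp only [Measure.smul_apply, Measure.finsetSum_apply, smul_eq_mul,
    Measure.dirac_apply' _ hs]
  refine Measurable.const_mul (Finset.measurable_fun_sum _ fun i _ => ?_) _
  exact (measurable_one.indicator hs).comp (measurable_pi_apply i)

end EmpiricalMeasure

/-! ### The joint model and its one-step return. -/

namespace MeanFieldModel

section Basic

variable {S A Z : Type*} [MeasurableSpace S] [MeasurableSpace A] [MeasurableSpace Z]
  (M : MeanFieldModel S A Z) {N : ℕ}

instance instIsProbabilityMeasureNoiseLaw : IsProbabilityMeasure (M.noiseLaw N) := by
  unfold noiseLaw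
  infer_instance

instance instNonemptyDecisionRule : Nonempty (M.DecisionRule N) := by
  obtain ⟨f, hf, hD⟩ := M.exists_selector
  exact ⟨⟨fun x i => f (x i), by fun_prop, fun x i => hD (x i)⟩⟩

/-- The joint action graph `{(𝐱, 𝐚) | 𝐚 ∈ 𝐃(𝐱)}`. -/
def jointGraph (N : ℕ) : Set ((Fin N → S) × (Fin N → A)) := {p | p.2 ∈ M.jointD p.1}

theorem isCompact_jointGraph [TopologicalSpace S] [TopologicalSpace A] (h : IsCompact M.graph) :
    IsCompact (M.jointGraph N) := by
  convert (isCompact_univ_pi fun _ : Fin N => h).image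
    (f := fun q : Fin N → S × A => (fun i => (q i).1, fun i => (q i).2)) (by fun_prop) using 1
  ext ⟨x, a⟩
  constructor
  · exact fun hxa => ⟨fun i => (x i, a i), fun i _ => hxa i, rfl⟩
  · rintro ⟨q, hq, hqe⟩
    obtain ⟨rfl, rfl⟩ := Prod.mk.inj hqe
    exact fun i => hq i trivial

variable [NeZero N]

theorem measurable_jointT : Measurable fun p : (Fin N → S) × (Fin N → A) × ((Fin N → Z) × Z) =>
    M.jointT p.1 p.2.1 (empiricalMeasure p.1) p.2.2 := by
  refine measurable_pi_lambda _ fun i => M.measurable_T.comp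
    (f := fun p : (Fin N → S) × (Fin N → A) × ((Fin N → Z) × Z) =>
      (p.1 i, p.2.1 i, empiricalMeasure p.1, p.2.2.1 i, p.2.2.2)) ?_
  have := measurable_empiricalMeasure (S := S) (N := N)
  fun_prop

theorem exists_abs_jointReward_le :
    ∃ C : ℝ, ∀ (x : Fin N → S) (a : Fin N → A), |M.jointReward x a| ≤ C := by
  obtain ⟨C, hC⟩ := M.bounded_r
  refine ⟨C, fun x a => ?_⟩
  have hN : (0 : ℝ) < N := by exact_mod_cast NeZero.pos N
  rw [jointReward, abs_mul, abs_of_pos (by positivity : 0 < 1 / (N : ℝ)), one_div,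
    inv_mul_le_iff₀ hN]
  calc |∑ i, M.r (x i) (a i) (empiricalMeasure x)|
      ≤ ∑ i, |M.r (x i) (a i) (empiricalMeasure x)| := Finset.abs_sum_le_sum_abs _ _
    _ ≤ ∑ _i : Fin N, C := Finset.sum_le_sum fun i _ => hC _ _ _
    _ = N * C := by simp

theorem exists_abs_oneStep_le {v : (Fin N → S) → ℝ} (hv : ∃ C : ℝ, ∀ x, |v x| ≤ C) :
    ∃ C : ℝ, ∀ (x : Fin N → S) (a : Fin N → A), |M.oneStep v x a| ≤ C := by
  obtain ⟨C, hC⟩ := hv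
  obtain ⟨R, hR⟩ := M.exists_abs_jointReward_le (N := N)
  refine ⟨R + M.β * C, fun x a => (abs_add_le _ _).trans (add_le_add (hR x a) ?_)⟩
  rw [abs_mul, abs_of_pos M.β_pos]
  refine mul_le_mul_of_nonneg_left ?_ M.β_pos.le
  simpa using norm_integral_le_of_norm_le_const (μ := M.noiseLaw N)
    (f := fun w => v (M.jointT x a (empiricalMeasure x) w)) (Eventually.of_forall fun w => hC _)

/-- Boundedness of `v` makes the real supremum a genuine upper bound. -/
theorem oneStep_le_bellman {v : (Fin N → S) → ℝ} (hv : ∃ C : ℝ, ∀ x, |v x| ≤ C)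
    {x : Fin N → S} {a : Fin N → A} (ha : a ∈ M.jointD x) :
    M.oneStep v x a ≤ M.bellman v x := by
  obtain ⟨C, hC⟩ := M.exists_abs_oneStep_le hv
  exact le_ciSup (f := fun a : M.jointD x => M.oneStep v x a)
    ⟨C, by rintro _ ⟨b, rfl⟩; exact (abs_le.1 (hC x b)).2⟩ ⟨a, ha⟩

end Basic

section OneStep

variable {S A Z : Type*}
  [TopologicalSpace S] [SecondCountableTopology S] [MeasurableSpace S] [BorelSpace S]
  [MeasurableSpace A] [MeasurableSpace Z]
  {M : MeanFieldModel S A Z} {N : ℕ} [NeZero N]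

theorem integrable_comp_jointT {v : (Fin N → S) → ℝ} (hv : v ∈ boundedUSC S N)
    (x : Fin N → S) (a : Fin N → A) :
    Integrable (fun w => v (M.jointT x a (empiricalMeasure x) w)) (M.noiseLaw N) := by
  obtain ⟨C, hC⟩ := hv.1
  exact Integrable.of_bound (hv.2.measurable.comp
    (M.measurable_jointT.comp (by fun_prop :
      Measurable fun w : (Fin N → Z) × Z => (x, a, w)))).aestronglyMeasurable C
      (Eventually.of_forall fun w => hC _)

theorem oneStep_le_oneStep_add {v w : (Fin N → S) → ℝ} (hv : v ∈ boundedUSC S N)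
    (hw : w ∈ boundedUSC S N) {ε : ℝ} (h : ∀ x, v x ≤ w x + ε) (x : Fin N → S) (a : Fin N → A) :
    M.oneStep v x a ≤ M.oneStep w x a + M.β * ε := by
  have key : ∫ ω, v (M.jointT x a (empiricalMeasure x) ω) ∂(M.noiseLaw N)
      ≤ ∫ ω, w (M.jointT x a (empiricalMeasure x) ω) ∂(M.noiseLaw N) + ε := by
    have hi := integrable_comp_jointT (M := M) hw x a
    calc _ ≤ ∫ ω, (w (M.jointT x a (empiricalMeasure x) ω) + ε) ∂(M.noiseLaw N) :=
          integral_mono (integrable_comp_jointT hv x a) (hi.add (integrable_const ε))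
            fun ω => h _
      _ = _ := by rw [integral_add hi (integrable_const ε)]; simp
  have := mul_le_mul_of_nonneg_left key M.β_pos.le
  unfold oneStep
  linarith

theorem upperSemicontinuous_jointReward [TopologicalSpace A]
    (hr : UpperSemicontinuous fun p : S × A × ProbabilityMeasure S => M.r p.1 p.2.1 p.2.2) :
    UpperSemicontinuous fun p : (Fin N → S) × (Fin N → A) => M.jointReward p.1 p.2 := by
  unfold jointReward
  have hc := continuous_empiricalMeasure (S := S) (N := N)
  refine (continuous_const_mul (1 / (N : ℝ))).comp_upperSemicontinuous
    (upperSemicontinuous_sum fun i _ => ?_) fun s t h =>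
      mul_le_mul_of_nonneg_left h (by positivity)
  exact hr.comp (g := fun p : (Fin N → S) × (Fin N → A) => (p.1 i, p.2 i, empiricalMeasure p.1))
    (by fun_prop)

/-- For fixed noise, `v` composed with the continuous transition is upper semicontinuous; uniform
boundedness lets this pass through the integral. Metrizability supplies the sequential topology. -/
theorem upperSemicontinuous_oneStep [TopologicalSpace.MetrizableSpace S] [TopologicalSpace A]
    [TopologicalSpace.MetrizableSpace A]
    (hr : UpperSemicontinuous fun p : S × A × ProbabilityMeasure S => M.r p.1 p.2.1 p.2.2)
    (hT : ∀ z z0 : Z, Continuous fun p : S × A × ProbabilityMeasure S =>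
      M.T p.1 p.2.1 p.2.2 z z0)
    {v : (Fin N → S) → ℝ} (hv : v ∈ boundedUSC S N) :
    UpperSemicontinuous fun p : (Fin N → S) × (Fin N → A) => M.oneStep v p.1 p.2 := by
  obtain ⟨C, hC⟩ := hv.1
  have hc := continuous_empiricalMeasure (S := S) (N := N)
  refine (upperSemicontinuous_jointReward hr).add
    ((continuous_const_mul M.β).comp_upperSemicontinuous ?_
      fun s t h => mul_le_mul_of_nonneg_left h M.β_pos.le)
  refine upperSemicontinuous_integral (C := C) (fun p => ?_) (fun p w => hC _) fun w => ?_
  · exact hv.2.measurable.comp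
      (M.measurable_jointT.comp (by fun_prop :
        Measurable fun w : (Fin N → Z) × Z => (p.1, p.2, w)))
  · refine hv.2.comp (continuous_pi fun i => ?_)
    exact (hT (w.1 i) w.2).comp
      (f := fun p : (Fin N → S) × (Fin N → A) => (p.1 i, p.2 i, empiricalMeasure p.1))
      (by fun_prop)

end OneStep

/-! ### The Bellman operator on 𝕄: attained suprema, invariance, contraction. -/

section Bellman

variable {S A Z : Type*}
  [TopologicalSpace S] [TopologicalSpace.MetrizableSpace S] [SecondCountableTopology S]
  [MeasurableSpace S] [BorelSpace S]
  [TopologicalSpace A] [TopologicalSpace.MetrizableSpace A] [SecondCountableTopology A]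
  [MeasurableSpace A] [BorelSpace A] [MeasurableSpace Z]
  {M : MeanFieldModel S A Z} {N : ℕ} [NeZero N]

theorem exists_isMaximizer
    (hD : IsCompact M.graph)
    (hr : UpperSemicontinuous fun p : S × A × ProbabilityMeasure S => M.r p.1 p.2.1 p.2.2)
    (hT : ∀ z z0 : Z, Continuous fun p : S × A × ProbabilityMeasure S =>
      M.T p.1 p.2.1 p.2.2 z z0)
    {v : (Fin N → S) → ℝ} (hv : v ∈ boundedUSC S N) :
    ∃ f : M.DecisionRule N, M.IsMaximizer f v := by
  obtain ⟨⟨f₀, -, hf₀⟩⟩ := M.instNonemptyDecisionRule (N := N)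
  obtain ⟨f, hf, hmax⟩ := exists_measurable_isMaxOn (M.isCompact_jointGraph (N := N) hD)
    (fun x => ⟨f₀ x, hf₀ x⟩) (upperSemicontinuous_oneStep hr hT hv)
  refine ⟨⟨f, hf, fun x => (hmax x).1⟩, fun x => le_antisymm ?_ ?_⟩
  · have : Nonempty (M.jointD x) := ⟨⟨f₀ x, hf₀ x⟩⟩
    exact ciSup_le fun a => (hmax x).2 a a.2
  · exact M.oneStep_le_bellman hv.1 (hmax x).1

theorem bellman_mem_boundedUSC
    (hD : IsCompact M.graph)
    (hr : UpperSemicontinuous fun p : S × A × ProbabilityMeasure S => M.r p.1 p.2.1 p.2.2)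
    (hT : ∀ z z0 : Z, Continuous fun p : S × A × ProbabilityMeasure S =>
      M.T p.1 p.2.1 p.2.2 z z0)
    {v : (Fin N → S) → ℝ} (hv : v ∈ boundedUSC S N) :
    M.bellman v ∈ boundedUSC S N := by
  obtain ⟨f, hf⟩ := exists_isMaximizer hD hr hT hv
  constructor
  · obtain ⟨C, hC⟩ := M.exists_abs_oneStep_le hv.1
    exact ⟨C, fun x => by rw [hf x]; exact hC _ _⟩
  · rw [upperSemicontinuous_iff_isClosed_preimage]
    intro c
    convert isClosed_setOf_exists_le (M.isCompact_jointGraph (N := N) hD) isClosed_univ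
      (upperSemicontinuous_oneStep hr hT hv) c using 1
    ext x
    constructor
    · exact fun h => ⟨f.1 x, trivial, f.2.2 x, (hf x).symm ▸ h⟩
    · exact fun ⟨a, _, ha, h⟩ => le_trans h (M.oneStep_le_bellman hv.1 ha)

/-- A maximizer of `v` is an admissible competitor for `w`, and the noise law has mass one, so the
gap `ε` only gets discounted. -/
theorem bellman_le_bellman_add
    (hD : IsCompact M.graph)
    (hr : UpperSemicontinuous fun p : S × A × ProbabilityMeasure S => M.r p.1 p.2.1 p.2.2)
    (hT : ∀ z z0 : Z, Continuous fun p : S × A × ProbabilityMeasure S =>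
      M.T p.1 p.2.1 p.2.2 z z0)
    {v w : (Fin N → S) → ℝ} (hv : v ∈ boundedUSC S N)
    (hw : w ∈ boundedUSC S N) {ε : ℝ} (h : ∀ x, v x ≤ w x + ε) (x : Fin N → S) :
    M.bellman v x ≤ M.bellman w x + M.β * ε := by
  obtain ⟨f, hf⟩ := exists_isMaximizer hD hr hT hv
  rw [hf x]
  have h1 := oneStep_le_oneStep_add (M := M) hv hw h x (f.1 x)
  have h2 := M.oneStep_le_bellman hw.1 (f.2.2 x)
  linarith

/-- The Bellman operator is a contraction in the supremum norm. -/
theorem abs_bellman_sub_le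
    (hD : IsCompact M.graph)
    (hr : UpperSemicontinuous fun p : S × A × ProbabilityMeasure S => M.r p.1 p.2.1 p.2.2)
    (hT : ∀ z z0 : Z, Continuous fun p : S × A × ProbabilityMeasure S =>
      M.T p.1 p.2.1 p.2.2 z z0)
    {v w : (Fin N → S) → ℝ} (hv : v ∈ boundedUSC S N)
    (hw : w ∈ boundedUSC S N) {ε : ℝ} (h : ∀ x, |v x - w x| ≤ ε) (x : Fin N → S) :
    |M.bellman v x - M.bellman w x| ≤ M.β * ε := by
  have h1 := bellman_le_bellman_add hD hr hT hv hw (ε := ε)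
    (fun y => by linarith [(abs_le.1 (h y)).2]) x
  have h2 := bellman_le_bellman_add hD hr hT hw hv (ε := ε)
    (fun y => by linarith [(abs_le.1 (h y)).1]) x
  rw [abs_le]
  constructor <;> linarith

theorem iterate_bellman_mem_boundedUSC
    (hD : IsCompact M.graph)
    (hr : UpperSemicontinuous fun p : S × A × ProbabilityMeasure S => M.r p.1 p.2.1 p.2.2)
    (hT : ∀ z z0 : Z, Continuous fun p : S × A × ProbabilityMeasure S =>
      M.T p.1 p.2.1 p.2.2 z z0)
    {v : (Fin N → S) → ℝ} (hv : v ∈ boundedUSC S N) (n : ℕ) :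
    (M.bellman (N := N))^[n] v ∈ boundedUSC S N := by
  induction n with
  | zero => exact hv
  | succ n ih =>
    rw [Function.iterate_succ_apply']
    exact bellman_mem_boundedUSC hD hr hT ih

end Bellman

end MeanFieldModel

/-! ### Value iteration and the fixed point. -/

theorem zero_mem_boundedUSC (S : Type*) [TopologicalSpace S] (N : ℕ) :
    (0 : (Fin N → S) → ℝ) ∈ boundedUSC S N :=
  ⟨⟨0, by simp⟩, upperSemicontinuous_const⟩

/-- The set of bounded upper semicontinuous functions is closed under uniform limits. -/
theorem mem_boundedUSC_of_tendstoUniformly {S : Type*} [TopologicalSpace S] {N : ℕ}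
    {v : ℕ → (Fin N → S) → ℝ} {w : (Fin N → S) → ℝ} (hv : ∀ n, v n ∈ boundedUSC S N)
    (h : TendstoUniformly v w atTop) : w ∈ boundedUSC S N := by
  rw [Metric.tendstoUniformly_iff] at h
  constructor
  · obtain ⟨n, hn⟩ := (h 1 one_pos).exists
    obtain ⟨C, hC⟩ := (hv n).1
    refine ⟨1 + C, fun x => ?_⟩
    have h1 := hn x
    rw [Real.dist_eq] at h1
    have := abs_sub_abs_le_abs_sub (w x) (v n x)
    linarith [hC x]
  · intro x y hy
    obtain ⟨n, hn⟩ := (h ((y - w x) / 2) (by linarith)).exists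
    have hx := abs_lt.1 (Real.dist_eq _ _ ▸ hn x)
    filter_upwards [(hv n).2 x ((y + w x) / 2) (by linarith)] with z hz
    have hz' := abs_lt.1 (Real.dist_eq _ _ ▸ hn z)
    linarith

namespace MeanFieldModel

/-- This is Banach's argument along the orbit of 0: successive differences are geometrically small
uniformly in the state, so pointwise limits exist with a uniform tail bound. -/
theorem exists_tendstoUniformly_iterate_bellman {S A Z : Type*}
    [TopologicalSpace S] [TopologicalSpace.MetrizableSpace S] [SecondCountableTopology S]
    [MeasurableSpace S] [BorelSpace S]
    [TopologicalSpace A] [TopologicalSpace.MetrizableSpace A] [SecondCountableTopology A]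
    [MeasurableSpace A] [BorelSpace A] [MeasurableSpace Z]
    {M : MeanFieldModel S A Z} {N : ℕ} [NeZero N] (hD : IsCompact M.graph)
    (hr : UpperSemicontinuous fun p : S × A × ProbabilityMeasure S => M.r p.1 p.2.1 p.2.2)
    (hT : ∀ z z0 : Z, Continuous fun p : S × A × ProbabilityMeasure S =>
      M.T p.1 p.2.1 p.2.2 z z0) :
    ∃ w ∈ boundedUSC S N, M.bellman w = w ∧
      TendstoUniformly (fun (n : ℕ) => (M.bellman (N := N))^[n] 0) w atTop := by
  set v : ℕ → (Fin N → S) → ℝ := fun n => (M.bellman (N := N))^[n] 0 with hv_def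
  have hv : ∀ n, v n ∈ boundedUSC S N := fun n =>
    iterate_bellman_mem_boundedUSC hD hr hT (zero_mem_boundedUSC S N) n
  have hsucc : ∀ n, v (n + 1) = M.bellman (v n) := fun n => Function.iterate_succ_apply' _ _ _
  -- `C` bounds the first increment, because the iteration starts at 0.
  obtain ⟨C, hC⟩ := (hv 1).1
  have hstep : ∀ n x, |v n x - v (n + 1) x| ≤ C * M.β ^ n := by
    intro n
    induction n with
    | zero => intro x; simpa [hv_def] using hC x
    | succ n ih =>
      intro x
      rw [hsucc (n + 1), hsucc n]
      refine (abs_bellman_sub_le hD hr hT (hv n) (hsucc n ▸ hv (n + 1))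
        (hsucc n ▸ ih) x).trans_eq ?_
      ring
  have hdist : ∀ x n, dist (v n x) (v (n + 1) x) ≤ C * M.β ^ n := fun x n => hstep n x
  choose w hw using fun x => cauchySeq_tendsto_of_complete
    (cauchySeq_of_le_geometric M.β C M.β_lt_one (hdist x))
  have hgeo : Tendsto (fun n => C * M.β ^ n / (1 - M.β)) atTop (𝓝 0) := by
    simpa using ((tendsto_pow_atTop_nhds_zero_of_lt_one M.β_pos.le M.β_lt_one).const_mul
      C).div_const (1 - M.β)
  have hunif : TendstoUniformly v w atTop := by
    rw [Metric.tendstoUniformly_iff]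
    intro ε hε
    filter_upwards [hgeo.eventually_lt_const hε] with n hn x
    rw [dist_comm]
    exact (dist_le_of_le_geometric_of_tendsto M.β C M.β_lt_one (hdist x) (hw x) n).trans_lt hn
  have hwM := mem_boundedUSC_of_tendstoUniformly hv hunif
  refine ⟨w, hwM, funext fun x => ?_, hunif⟩
  -- By contraction, the shifted iterates converge both to `w` and to its image under `M.bellman`.
  refine tendsto_nhds_unique ?_ ((hw x).comp (tendsto_add_atTop_nat 1))
  rw [tendsto_iff_dist_tendsto_zero]
  refine squeeze_zero (fun _ => dist_nonneg) (fun n => ?_)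
    (by simpa using hgeo.const_mul M.β)
  simp only [Function.comp_apply, hsucc]
  exact abs_bellman_sub_le hD hr hT (hv n) hwM
    (fun y => dist_le_of_le_geometric_of_tendsto M.β C M.β_lt_one (hdist y) (hw y) n) x

end MeanFieldModel

/-! ### Independence and telescoping along trajectories. -/

namespace MeanFieldModel

section Trajectory

variable {S A Z : Type*} [MeasurableSpace S] [MeasurableSpace A] [MeasurableSpace Z]
  (M : MeanFieldModel S A Z) {N : ℕ} [NeZero N]

/-- The law of the whole noise sequence. -/
noncomputable abbrev noiseSeqLaw (N : ℕ) : Measure (ℕ → (Fin N → Z) × Z) :=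
  Measure.infinitePi fun _ : ℕ => M.noiseLaw N

theorem measurable_trajectory_apply (π : M.Policy N) (x : Fin N → S) (n : ℕ) :
    Measurable fun w => M.trajectory π x w n := by
  induction n with
  | zero => exact measurable_const
  | succ n ih =>
    exact M.measurable_jointT.comp
      (ih.prodMk (((π n).2.1.comp ih).prodMk (measurable_pi_apply n)))

theorem measurable_trajectory (π : M.Policy N) (x : Fin N → S) :
    Measurable (M.trajectory π x) :=
  measurable_pi_lambda _ fun n => M.measurable_trajectory_apply π x n

theorem trajectory_congr (π : M.Policy N) (x : Fin N → S) {n : ℕ}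
    {w w' : ℕ → (Fin N → Z) × Z} (h : ∀ k < n, w k = w' k) :
    M.trajectory π x w n = M.trajectory π x w' n := by
  induction n with
  | zero => rfl
  | succ n ih =>
    simp only [trajectory]
    rw [ih fun k hk => h k (hk.trans n.lt_succ_self), h n n.lt_succ_self]

open ProbabilityTheory in
/-- The state at time `n` is independent of the noise that drives the next transition. -/
theorem indepFun_trajectory (π : M.Policy N) (x : Fin N → S) (n : ℕ) :
    IndepFun (fun w => M.trajectory π x w n) (fun w => w n) (M.noiseSeqLaw N) := by
  obtain ⟨z⟩ := nonempty_of_isProbabilityMeasure (M.noiseLaw N)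
  have hind : iIndepFun (fun (k : ℕ) (w : ℕ → (Fin N → Z) × Z) => w k) (M.noiseSeqLaw N) :=
    iIndepFun_infinitePi (P := fun _ : ℕ => M.noiseLaw N) (X := fun _ ω => ω) fun _ => measurable_id
  have h := hind.indepFun_finset (Finset.range n) {n} (by simp) fun k => measurable_pi_apply k
  -- Padding the first `n` noises with the constant `z` exhibits the state at time `n` as a
  -- measurable function of those noises alone.
  let ext : (Finset.range n → (Fin N → Z) × Z) → ℕ → (Fin N → Z) × Z :=
    fun u k => if hk : k ∈ Finset.range n then u ⟨k, hk⟩ else z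
  have hext : Measurable ext := by
    refine measurable_pi_lambda _ fun k => ?_
    by_cases hk : k ∈ Finset.range n
    · simp only [ext, hk, dite_true]
      exact measurable_pi_apply _
    · simp only [ext, hk, dite_false]
      exact measurable_const
  have h' := h.comp ((M.measurable_trajectory_apply π x n).comp hext)
    (measurable_pi_apply (⟨n, Finset.mem_singleton_self n⟩ : ({n} : Finset ℕ)))
  have hX : (fun w => M.trajectory π x w n)
      = ((fun w => M.trajectory π x w n) ∘ ext) ∘ fun w (k : Finset.range n) => w k := by
    funext w
    refine M.trajectory_congr π x fun k hk => ?_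
    simp [ext, hk]
  rw [hX]
  exact h'

/-- By independence the joint law of state and next noise is a product, so Fubini integrates the
noise out with the state frozen. -/
theorem integral_comp_trajectory_prodMk (π : M.Policy N) (x : Fin N → S) (n : ℕ)
    {g : (Fin N → S) × ((Fin N → Z) × Z) → ℝ} (hg : Measurable g) {C : ℝ} (hC : ∀ p, |g p| ≤ C) :
    ∫ w, g (M.trajectory π x w n, w n) ∂(M.noiseSeqLaw N)
      = ∫ w, ∫ z, g (M.trajectory π x w n, z) ∂(M.noiseLaw N) ∂(M.noiseSeqLaw N) := by
  have hX := M.measurable_trajectory_apply π x n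
  have hlaw := (ProbabilityTheory.indepFun_iff_map_prod_eq_prod_map_map hX.aemeasurable
    (measurable_pi_apply n).aemeasurable).1 (M.indepFun_trajectory π x n)
  have hn : (M.noiseSeqLaw N).map (fun w => w n) = M.noiseLaw N :=
    Measure.infinitePi_map_eval (fun _ : ℕ => M.noiseLaw N) n
  rw [hn] at hlaw
  have : IsProbabilityMeasure ((M.noiseSeqLaw N).map fun w => M.trajectory π x w n) :=
    Measure.isProbabilityMeasure_map hX.aemeasurable
  rw [← integral_map (f := g) (hX.prodMk (measurable_pi_apply n)).aemeasurable
    hg.aestronglyMeasurable, hlaw, integral_prod _ (Integrable.of_bound hg.aestronglyMeasurable C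
      (Eventually.of_forall hC)), integral_map hX.aemeasurable]
  exact hg.stronglyMeasurable.integral_prod_right'.aestronglyMeasurable

theorem tendsto_pow_mul_integral_trajectory {v : (Fin N → S) → ℝ} (hv : ∃ C : ℝ, ∀ x, |v x| ≤ C)
    (π : M.Policy N) (x : Fin N → S) :
    Tendsto (fun k => M.β ^ k * ∫ w, v (M.trajectory π x w k) ∂(M.noiseSeqLaw N)) atTop (𝓝 0) := by
  obtain ⟨C, hC⟩ := hv
  refine squeeze_zero_norm (a := fun k => M.β ^ k * C) (fun k => ?_) (by
    simpa using (tendsto_pow_atTop_nhds_zero_of_lt_one M.β_pos.le M.β_lt_one).mul_const C)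
  rw [norm_mul, Real.norm_of_nonneg (pow_nonneg M.β_pos.le k)]
  refine mul_le_mul_of_nonneg_left ?_ (pow_nonneg M.β_pos.le k)
  simpa using norm_integral_le_of_norm_le_const (μ := M.noiseSeqLaw N)
    (f := fun w => v (M.trajectory π x w k)) (Eventually.of_forall fun w => hC _)

/-- The partial sums collapse to `v x` minus a discounted mean of a bounded function. This is the
series against which discounted rewards are compared. -/
theorem tendsto_telescope_trajectory {v : (Fin N → S) → ℝ} (hv : ∃ C : ℝ, ∀ x, |v x| ≤ C)
    (π : M.Policy N) (x : Fin N → S) :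
    Tendsto (fun n => ∑ k ∈ Finset.range n,
      (M.β ^ k * ∫ w, v (M.trajectory π x w k) ∂(M.noiseSeqLaw N)
        - M.β ^ (k + 1) * ∫ w, v (M.trajectory π x w (k + 1)) ∂(M.noiseSeqLaw N)))
      atTop (𝓝 (v x)) := by
  simp_rw [Finset.sum_range_sub' fun k =>
    M.β ^ k * ∫ w, v (M.trajectory π x w k) ∂(M.noiseSeqLaw N)]
  simpa [trajectory] using (M.tendsto_pow_mul_integral_trajectory hv π x).const_sub (v x)

end Trajectory

/-! ### Verification: comparing policy values with functions in 𝕄. -/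

section Verification

variable {S A Z : Type*}
  [TopologicalSpace S] [SecondCountableTopology S] [MeasurableSpace S] [BorelSpace S]
  [TopologicalSpace A] [SecondCountableTopology A] [MeasurableSpace A] [BorelSpace A]
  [MeasurableSpace Z] {M : MeanFieldModel S A Z} {N : ℕ} [NeZero N]

/-- Measurability comes from upper semicontinuity. The empirical measure is substituted first, so
only Borel sets of the product of the state and action spaces matter, not those of
`ProbabilityMeasure S`. -/
theorem measurable_reward_comp
    (hr : UpperSemicontinuous fun p : S × A × ProbabilityMeasure S => M.r p.1 p.2.1 p.2.2)
    {f : (Fin N → S) → Fin N → A} (hf : Measurable f) (i : Fin N) :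
    Measurable fun x : Fin N → S => M.r (x i) (f x i) (empiricalMeasure x) := by
  have hc := continuous_empiricalMeasure (S := S) (N := N)
  have h : UpperSemicontinuous fun p : (Fin N → S) × (Fin N → A) =>
      M.r (p.1 i) (p.2 i) (empiricalMeasure p.1) :=
    hr.comp (g := fun p : (Fin N → S) × (Fin N → A) => (p.1 i, p.2 i, empiricalMeasure p.1))
      (by fun_prop)
  exact h.measurable.comp (g := fun p : (Fin N → S) × (Fin N → A) =>
    M.r (p.1 i) (p.2 i) (empiricalMeasure p.1)) (measurable_id.prodMk hf)

theorem measurable_jointReward_comp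
    (hr : UpperSemicontinuous fun p : S × A × ProbabilityMeasure S => M.r p.1 p.2.1 p.2.2)
    {f : (Fin N → S) → Fin N → A} (hf : Measurable f) :
    Measurable fun x : Fin N → S => M.jointReward x (f x) :=
  (Finset.measurable_fun_sum _ fun i _ => measurable_reward_comp hr hf i).const_mul _

/-- The expected reward of the population in period `k`. -/
noncomputable def expectedReward (M : MeanFieldModel S A Z) (π : M.Policy N) (x : Fin N → S) (k : ℕ) : ℝ :=
  ∫ w, M.jointReward (M.trajectory π x w k) ((π k).1 (M.trajectory π x w k)) ∂(M.noiseSeqLaw N)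

/-- Bounded rewards and geometric discounting allow the finite sum over individuals to be exchanged
with the sum over time. -/
theorem hasSum_policyValue
    (hr : UpperSemicontinuous fun p : S × A × ProbabilityMeasure S => M.r p.1 p.2.1 p.2.2)
    (π : M.Policy N) (x : Fin N → S) :
    HasSum (fun k => M.β ^ k * M.expectedReward π x k) (M.policyValue π x) := by
  obtain ⟨C, hC⟩ := M.bounded_r
  have hX := M.measurable_trajectory_apply π x
  have hmeas := fun k i => measurable_reward_comp hr (π k).2.1 i
  have hmap : ∀ k i, ∫ ω, M.r (ω k i) ((π k).1 (ω k) i) (empiricalMeasure (ω k)) ∂(M.pathLaw π x)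
      = ∫ w, M.r (M.trajectory π x w k i) ((π k).1 (M.trajectory π x w k) i)
          (empiricalMeasure (M.trajectory π x w k)) ∂(M.noiseSeqLaw N) := fun k i =>
    integral_map (M.measurable_trajectory π x).aemeasurable
      ((hmeas k i).comp (measurable_pi_apply k)).aestronglyMeasurable
  have hint : ∀ k i, Integrable (fun w => M.r (M.trajectory π x w k i)
      ((π k).1 (M.trajectory π x w k) i) (empiricalMeasure (M.trajectory π x w k)))
      (M.noiseSeqLaw N) := fun k i =>
    Integrable.of_bound ((hmeas k i).comp (hX k)).aestronglyMeasurable C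
      (Eventually.of_forall fun w => hC _ _ _)
  have hsum : ∀ i, Summable fun k => M.β ^ k * ∫ ω, M.r (ω k i) ((π k).1 (ω k) i)
      (empiricalMeasure (ω k)) ∂(M.pathLaw π x) := by
    intro i
    refine Summable.of_norm_bounded (g := fun k => M.β ^ k * C)
      ((summable_geometric_of_lt_one M.β_pos.le M.β_lt_one).mul_right C) fun k => ?_
    rw [norm_mul, Real.norm_of_nonneg (pow_nonneg M.β_pos.le k), hmap]
    refine mul_le_mul_of_nonneg_left ?_ (pow_nonneg M.β_pos.le k)
    simpa using norm_integral_le_of_norm_le_const (μ := M.noiseSeqLaw N)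
      (f := fun w => M.r (M.trajectory π x w k i) ((π k).1 (M.trajectory π x w k) i)
        (empiricalMeasure (M.trajectory π x w k))) (Eventually.of_forall fun w => hC _ _ _)
  have hterm : ∀ k, M.β ^ k * M.expectedReward π x k = 1 / (N : ℝ) * ∑ i, M.β ^ k *
      ∫ ω, M.r (ω k i) ((π k).1 (ω k) i) (empiricalMeasure (ω k)) ∂(M.pathLaw π x) := by
    intro k
    simp only [expectedReward, jointReward, hmap]
    rw [integral_const_mul, integral_finsetSum _ fun i _ => hint k i, ← Finset.mul_sum]
    ring
  simp only [hterm]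
  exact (hasSum_sum fun i (_ : i ∈ Finset.univ) => (hsum i).hasSum).mul_left (1 / (N : ℝ))

/-- The dynamic programming identity along a trajectory. -/
theorem integral_oneStep_trajectory
    (hr : UpperSemicontinuous fun p : S × A × ProbabilityMeasure S => M.r p.1 p.2.1 p.2.2)
    {v : (Fin N → S) → ℝ} (hv : v ∈ boundedUSC S N)
    (π : M.Policy N) (x : Fin N → S) (k : ℕ) :
    Integrable (fun w => M.oneStep v (M.trajectory π x w k) ((π k).1 (M.trajectory π x w k)))
        (M.noiseSeqLaw N) ∧
      ∫ w, M.oneStep v (M.trajectory π x w k) ((π k).1 (M.trajectory π x w k)) ∂(M.noiseSeqLaw N)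
        = M.expectedReward π x k
          + M.β * ∫ w, v (M.trajectory π x w (k + 1)) ∂(M.noiseSeqLaw N) := by
  obtain ⟨C, hC⟩ := hv.1
  obtain ⟨R, hR⟩ := M.exists_abs_jointReward_le (N := N)
  have hX := M.measurable_trajectory_apply π x k
  have hg : Measurable fun p : (Fin N → S) × ((Fin N → Z) × Z) =>
      v (M.jointT p.1 ((π k).1 p.1) (empiricalMeasure p.1) p.2) :=
    hv.2.measurable.comp (M.measurable_jointT.comp
      (measurable_fst.prodMk (((π k).2.1.comp measurable_fst).prodMk measurable_snd)))
  have hi₁ : Integrable (fun w => M.jointReward (M.trajectory π x w k)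
      ((π k).1 (M.trajectory π x w k))) (M.noiseSeqLaw N) :=
    Integrable.of_bound ((measurable_jointReward_comp hr (π k).2.1).comp hX).aestronglyMeasurable R
      (Eventually.of_forall fun w => hR _ _)
  have hi₂ : Integrable (fun w => ∫ z, v (M.jointT (M.trajectory π x w k)
      ((π k).1 (M.trajectory π x w k)) (empiricalMeasure (M.trajectory π x w k)) z)
      ∂(M.noiseLaw N)) (M.noiseSeqLaw N) := by
    refine Integrable.of_bound
      (hg.stronglyMeasurable.integral_prod_right'.measurable.comp hX).aestronglyMeasurable C
      (Eventually.of_forall fun w => ?_)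
    simpa using norm_integral_le_of_norm_le_const (μ := M.noiseLaw N)
      (f := fun z => v (M.jointT (M.trajectory π x w k)
        ((π k).1 (M.trajectory π x w k)) (empiricalMeasure (M.trajectory π x w k)) z))
      (Eventually.of_forall fun z => hC _)
  refine ⟨hi₁.add (hi₂.const_mul M.β), ?_⟩
  have h := M.integral_comp_trajectory_prodMk π x k hg (fun p => hC _)
  simp only [oneStep]
  rw [integral_add hi₁ (hi₂.const_mul M.β), integral_const_mul, ← h]
  rfl

/-- A superharmonic function dominates the value of a policy. -/
theorem policyValue_le
    (hr : UpperSemicontinuous fun p : S × A × ProbabilityMeasure S => M.r p.1 p.2.1 p.2.2)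
    {v : (Fin N → S) → ℝ} (hv : v ∈ boundedUSC S N) {π : M.Policy N}
    (h : ∀ k y, M.oneStep v y ((π k).1 y) ≤ v y) (x : Fin N → S) :
    M.policyValue π x ≤ v x := by
  refine le_of_tendsto_of_tendsto' (hasSum_policyValue hr π x).tendsto_sum_nat
    (M.tendsto_telescope_trajectory hv.1 π x) fun n => Finset.sum_le_sum fun k _ => ?_
  obtain ⟨hi, heq⟩ := integral_oneStep_trajectory hr hv π x k
  obtain ⟨C, hC⟩ := hv.1
  have hle := integral_mono hi (Integrable.of_bound (hv.2.measurable.comp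
    (M.measurable_trajectory_apply π x k)).aestronglyMeasurable C
    (Eventually.of_forall fun w => hC _)) fun w => h k (M.trajectory π x w k)
  -- Discounting the mean inequality at time `k` bounds the reward by the `k`-th telescoping term.
  have := mul_le_mul_of_nonneg_left (heq ▸ hle) (pow_nonneg M.β_pos.le k)
  rw [pow_succ]
  simp only [Function.comp_apply] at this
  linarith

/-- A harmonic function is the value of the policy. -/
theorem policyValue_eq
    (hr : UpperSemicontinuous fun p : S × A × ProbabilityMeasure S => M.r p.1 p.2.1 p.2.2)
    {v : (Fin N → S) → ℝ} (hv : v ∈ boundedUSC S N) {π : M.Policy N}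
    (h : ∀ k y, M.oneStep v y ((π k).1 y) = v y) (x : Fin N → S) :
    M.policyValue π x = v x := by
  refine tendsto_nhds_unique (hasSum_policyValue hr π x).tendsto_sum_nat ?_
  convert M.tendsto_telescope_trajectory hv.1 π x using 3 with n k
  have heq := (integral_oneStep_trajectory hr hv π x k).2
  simp only [h] at heq
  rw [heq]
  ring

theorem policyValue_eq_of_isMaximizer
    (hr : UpperSemicontinuous fun p : S × A × ProbabilityMeasure S => M.r p.1 p.2.1 p.2.2)
    {v : (Fin N → S) → ℝ} (hv : v ∈ boundedUSC S N) (hfix : M.bellman v = v)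
    {f : M.DecisionRule N} (hf : M.IsMaximizer f v) (x : Fin N → S) :
    M.policyValue (fun _ => f) x = v x :=
  policyValue_eq hr hv (fun _ y => by rw [← hf y, hfix]) x

end Verification

end MeanFieldModel

/-! ### Identification of the value function and conclusion. -/

namespace MeanFieldModel

section ValueFunction

variable {S A Z : Type*}
  [TopologicalSpace S] [TopologicalSpace.MetrizableSpace S] [SecondCountableTopology S]
  [MeasurableSpace S] [BorelSpace S]
  [TopologicalSpace A] [TopologicalSpace.MetrizableSpace A] [SecondCountableTopology A]
  [MeasurableSpace A] [BorelSpace A] [MeasurableSpace Z]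
  {M : MeanFieldModel S A Z} {N : ℕ} [NeZero N]

/-- A fixed point of the Bellman operator is the value function. -/
theorem eq_value_of_bellman_eq (hD : IsCompact M.graph)
    (hr : UpperSemicontinuous fun p : S × A × ProbabilityMeasure S => M.r p.1 p.2.1 p.2.2)
    (hT : ∀ z z0 : Z, Continuous fun p : S × A × ProbabilityMeasure S =>
      M.T p.1 p.2.1 p.2.2 z z0)
    {v : (Fin N → S) → ℝ} (hv : v ∈ boundedUSC S N) (hfix : M.bellman v = v) :
    v = M.value := by
  obtain ⟨f, hf⟩ := exists_isMaximizer hD hr hT hv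
  have hle : ∀ (π : M.Policy N) x, M.policyValue π x ≤ v x := fun π x =>
    policyValue_le hr hv (fun k y =>
      (M.oneStep_le_bellman hv.1 ((π k).2.2 y)).trans_eq (congrFun hfix y)) x
  funext x
  -- The upper bound by `v` serves twice: it bounds the supremum over policies and makes it a true
  -- supremum, which a maximizer's stationary policy attains.
  refine le_antisymm ?_ (ciSup_le fun π => hle π x)
  rw [← policyValue_eq_of_isMaximizer hr hv hfix hf x]
  exact le_ciSup (f := fun π : M.Policy N => M.policyValue π x)
    ⟨v x, by rintro _ ⟨π, rfl⟩; exact hle π x⟩ fun _ => f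

end ValueFunction

end MeanFieldModel

theorem theorem2p2 {S A Z : Type*}
    [TopologicalSpace S] [CompactSpace S] [TopologicalSpace.MetrizableSpace S]
    [MeasurableSpace S] [BorelSpace S]
    [TopologicalSpace A] [TopologicalSpace.MetrizableSpace A] [SecondCountableTopology A]
    [MeasurableSpace A] [BorelSpace A] [StandardBorelSpace A]
    [MeasurableSpace Z] [StandardBorelSpace Z]
    (M : MeanFieldModel S A Z) (N : ℕ) [NeZero N]
    (hA0 : IsCompact M.graph)
    (hA1 : ∀ (x : S) (xs : ℕ → S) (as : ℕ → A), Tendsto xs atTop (𝓝 x) →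
      (∀ n, as n ∈ M.D (xs n)) → ∃ a ∈ M.D x, MapClusterPt a atTop as)
    (hA2 : UpperSemicontinuous fun p : S × A × ProbabilityMeasure S => M.r p.1 p.2.1 p.2.2)
    (hA3 : ∀ z z0 : Z, Continuous fun p : S × A × ProbabilityMeasure S =>
      M.T p.1 p.2.1 p.2.2 z z0) :
    -- the value function is the unique fixed point of the Bellman operator `U : 𝕄 → 𝕄`
    (Set.MapsTo (M.bellman (N := N)) (boundedUSC S N) (boundedUSC S N) ∧
      M.value ∈ boundedUSC S N ∧
      M.bellman (N := N) M.value = M.value ∧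
      ∀ v ∈ boundedUSC S N, M.bellman v = v → v = M.value) ∧
    -- value iteration converges (in the supremum norm)
    TendstoUniformly (fun (n : ℕ) => (M.bellman (N := N))^[n] 0) M.value atTop ∧
    -- maximizers exist and define optimal stationary policies
    (∃ f : M.DecisionRule N, M.IsMaximizer f M.value) ∧
    ∀ f : M.DecisionRule N, M.IsMaximizer f M.value → M.IsOptimal fun _ => f := by
  have hS : SecondCountableTopology S := by
    let _ : MetricSpace S := TopologicalSpace.metrizableSpaceMetric S
    infer_instance
  obtain ⟨w, hw, hfix, hlim⟩ :=
    MeanFieldModel.exists_tendstoUniformly_iterate_bellman (N := N) hA0 hA2 hA3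
  -- Once the iteration limit is identified with the value function, the latter inherits membership
  -- in 𝕄, the fixed-point equation and the uniform convergence.
  have hwv := MeanFieldModel.eq_value_of_bellman_eq hA0 hA2 hA3 hw hfix
  subst hwv
  exact ⟨⟨fun v hv => MeanFieldModel.bellman_mem_boundedUSC hA0 hA2 hA3 hv, hw, hfix,
      fun v hv h => MeanFieldModel.eq_value_of_bellman_eq hA0 hA2 hA3 hv h⟩, hlim,
    MeanFieldModel.exists_isMaximizer hA0 hA2 hA3 hw,
    fun f hf x => MeanFieldModel.policyValue_eq_of_isMaximizer hA2 hw hfix hf x⟩
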